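/- Let $G$ be a finite connected multigraph, i.e. a graph with finite nonempty vertex set $V(G)$ and finite edge set $E(G)$, in which several edges may join the same vertices (loops are allowed as well). For a finite nonempty multigraph $H$ put $g(H)=|E(H)|-|V(H)|+1$, and for $\emptyset\neq S\subseteq V(G)$ let $G[S]$ be the subgraph of $G$ induced by $S$. A break divisor on $G$ is a map $D:V(G)\to\mathbb{Z}$ with $D(v)\ge 0$ for all $v\in V(G)$, with $\sum_{v\in V(G)}D(v)=g(G)$, and with $$\sum_{v\in S}D(v)\ \ge\ g(G[S])\qquad\text{for every nonempty } S\subseteq V(G).$$ A spanning tree of $G$ is a connected subgraph of $G$ without cycles that contains all the vertices of $G$. Then $G$ has only finitely many break divisors and only finitely many spanning trees, and the number of break divisors on $G$ equals the number of spanning trees of $G$. -/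

import Mathlib

open scoped Graph

namespace Graph

/-- A multigraph is connected if it has a vertex and any two of its vertices are joined by a
sequence of consecutively adjacent vertices. -/
def Connected {α β : Type*} (G : Graph α β) : Prop :=
  V(G).Nonempty ∧ ∀ x ∈ V(G), ∀ y ∈ V(G), Relation.ReflTransGen G.Adj x y

/-- A multigraph has a cycle if, for some `k`, there are distinct vertices `v 0, …, v k` and distinct edges
`e 0, …, e k` such that `e i` joins `v i` to `v (i + 1)`, where `i + 1` is read cyclically.
For `k = 0` this is a loop, for `k = 1` a pair of parallel edges. -/
def HasCycle {α β : Type*} (G : Graph α β) : Prop :=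
  ∃ (k : ℕ) (v : Fin (k + 1) → α) (e : Fin (k + 1) → β),
    Function.Injective v ∧ Function.Injective e ∧ ∀ i, G.IsLink (e i) (v i) (v (i + 1))

/-- A tree is a connected multigraph without cycles. -/
def IsTree {α β : Type*} (G : Graph α β) : Prop :=
  G.Connected ∧ ¬ G.HasCycle

/-- The spanning trees of `G`: the subgraphs of `G` on all the vertices of `G` that are trees. -/
def spanningTrees {α β : Type*} (G : Graph α β) : Set (Graph α β) :=
  {T | T ≤s G ∧ T.IsTree}

/-- The number `|E(G)| - |V(G)| + 1`, for a finite multigraph `G`. -/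
noncomputable def genus {α β : Type*} (G : Graph α β) : ℤ :=
  (E(G).ncard : ℤ) - (V(G).ncard : ℤ) + 1

/-- A divisor on `G` is an integer-valued function on the vertices of `G`. -/
abbrev Divisor {α β : Type*} (G : Graph α β) : Type _ := V(G) → ℤ

/-- A divisor is effective if all its values are nonnegative. -/
def Divisor.Effective {α β : Type*} {G : Graph α β} (D : G.Divisor) : Prop :=
  ∀ v, 0 ≤ D v

/-- The degree of a divisor (on a graph with finitely many vertices). -/
noncomputable def Divisor.degree {α β : Type*} {G : Graph α β} (D : G.Divisor) : ℤ :=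
  ∑ᶠ v : V(G), D v

/-- The degree of the restriction of a divisor to the vertices in `S`. -/
noncomputable def Divisor.degreeOn {α β : Type*} {G : Graph α β} (D : G.Divisor) (S : Set α) : ℤ :=
  ∑ᶠ (v : V(G)) (_ : (v : α) ∈ S), D v

/-- A break divisor on `G` is an effective divisor of degree `g(G)` such that
`deg (D|_H) ≥ g(H)` for every induced subgraph `H = G[S]`, `∅ ≠ S ⊆ V(G)`. -/
def Divisor.IsBreak {α β : Type*} {G : Graph α β} (D : G.Divisor) : Prop :=
  D.Effective ∧ D.degree = G.genus ∧
    ∀ S : Set α, S ⊆ V(G) → S.Nonempty → (G.induce S).genus ≤ D.degreeOn S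

/-- The set `Break(G)` of break divisors on `G`. -/
def breakDivisors {α β : Type*} (G : Graph α β) : Set G.Divisor :=
  {D | D.IsBreak}

end Graph

namespace Multigraph

open Finset

set_option linter.unusedSectionVars false

variable {α β : Type*} [DecidableEq α] [DecidableEq β]

/-! Raising a divisor by one at every vertex turns the break conditions into x(S) ≥ |E[S]| + 1 for
all nonempty S, with equality at S = V. These score vectors obey the same deletion–contraction
recursion as spanning trees.

Let e be an edge from u to v ≠ u, and call T tight if x(T) = |E[T]| + 1. The vectors with no tight
set containing v but not u are those of G − e raised by one at v (`image_add_single`). The others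
correspond to the vectors of G/e by adding the divisor values at u and v: a tight set fixes how the
sum splits (`contractVec_injOn`), and supermodularity of |E[S]| makes the extreme split admissible
(`exists_contractVec_eq`). Induction on |E| ends when all edges are loops, where both counts are 1
or both are 0. The induction does not assume connectedness, which deletion may destroy.

Spanning trees enter the recursion as edge sets that cross every cut and have |V| − 1 elements
(`Represents.isTree_iff`). -/

/-- The edges in `E` with both ends in `S`, where `s e` and `t e` are the ends of `e`. -/
def inner (s t : β → α) (E : Finset β) (S : Finset α) : Finset β :=
  E.filter fun e => s e ∈ S ∧ t e ∈ S

/-- The break divisors of the multigraph `(V, E)` with all values raised by one, and extended by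
zero outside `V`. -/
def scoreVectors (s t : β → α) (V : Finset α) (E : Finset β) : Set (α → ℤ) :=
  {x | (∀ a ∉ V, x a = 0) ∧
    (∀ S ⊆ V, S.Nonempty → (#(inner s t E S) : ℤ) + 1 ≤ ∑ a ∈ S, x a) ∧
    ∑ a ∈ V, x a = #E + 1}

/-- Every cut of the vertex set `V` is crossed by an edge in `F`. -/
def CutConnected (s t : β → α) (V : Finset α) (F : Finset β) : Prop :=
  ∀ S ⊆ V, S.Nonempty → S ≠ V → ∃ e ∈ F, ¬ (s e ∈ S ↔ t e ∈ S)

open Classical in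
/-- The edge sets of the spanning trees of `(V, E)`. -/
noncomputable def treeEdgeSets (s t : β → α) (V : Finset α) (E : Finset β) : Finset (Finset β) :=
  E.powerset.filter fun F => CutConnected s t V F ∧ #F + 1 = #V

/-- The map that identifies the vertex `v` with `u`. -/
def merge (u v a : α) : α := if a = v then u else a

/-- The preimage of a vertex set under the map that identifies `v` with `u`. -/
def unmerge (u v : α) (S : Finset α) : Finset α := if u ∈ S then insert v S else S

lemma mem_treeEdgeSets {s t : β → α} {V : Finset α} {E F : Finset β} :
    F ∈ treeEdgeSets s t V E ↔ F ⊆ E ∧ CutConnected s t V F ∧ #F + 1 = #V := by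
  classical
  simp [treeEdgeSets]

lemma mem_inner {s t : β → α} {E : Finset β} {S : Finset α} {e : β} :
    e ∈ inner s t E S ↔ e ∈ E ∧ s e ∈ S ∧ t e ∈ S := by
  simp [inner]

lemma inner_eq_self {s t : β → α} {E : Finset β} {V : Finset α}
    (hs : ∀ e ∈ E, s e ∈ V) (ht : ∀ e ∈ E, t e ∈ V) : inner s t E V = E := by
  ext e
  simp only [mem_inner]
  exact ⟨fun h => h.1, fun h => ⟨h, hs e h, ht e h⟩⟩

lemma inner_empty (s t : β → α) (E : Finset β) : inner s t E ∅ = ∅ := by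
  simp [inner]

lemma merge_mem_iff {u v a : α} {S : Finset α} (hv : v ∉ S) :
    merge u v a ∈ S ↔ a ∈ unmerge u v S := by
  unfold merge unmerge
  split_ifs with h1 h2 h2
  · simp [h1, h2]
  · simp [h1, h2, hv]
  · simp [h1]
  · rfl

lemma merge_mem_erase_iff {u v a : α} {S : Finset α} (huv : u ≠ v) (h : u ∈ S ↔ v ∈ S) :
    merge u v a ∈ S.erase v ↔ a ∈ S := by
  unfold merge
  split_ifs with h1
  · simp [h1, huv, h]
  · simp [h1]

lemma unmerge_erase {u v : α} {S : Finset α} (huv : u ≠ v) (h : u ∈ S ↔ v ∈ S) :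
    unmerge u v (S.erase v) = S := by
  ext a
  rw [← merge_mem_iff (notMem_erase v S), merge_mem_erase_iff huv h]

/-! ### Deletion–contraction for score vectors. -/

section Recursion

variable {s t : β → α} {V : Finset α} {E : Finset β} {e : β}

lemma inner_erase_of_mem {S : Finset α} (he : e ∈ E) (hs : s e ∈ S) (ht : t e ∈ S) :
    #(inner s t (E.erase e) S) + 1 = #(inner s t E S) := by
  have : inner s t (E.erase e) S = (inner s t E S).erase e := by
    ext f; simp [mem_inner, and_assoc]
  rw [this, card_erase_add_one]
  exact mem_inner.2 ⟨he, hs, ht⟩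

lemma inner_erase_of_not_mem {S : Finset α} (h : ¬ (s e ∈ S ∧ t e ∈ S)) :
    inner s t (E.erase e) S = inner s t E S := by
  ext f
  simp only [mem_inner, mem_erase]
  constructor
  · rintro ⟨⟨_, h1⟩, h2⟩
    exact ⟨h1, h2⟩
  · rintro ⟨h1, h2⟩
    refine ⟨⟨?_, h1⟩, h2⟩
    rintro rfl
    exact h h2

lemma inner_merge {S : Finset α} {u v : α} (hv : v ∉ S) :
    inner (merge u v ∘ s) (merge u v ∘ t) E S = inner s t E (unmerge u v S) := by
  ext f
  simp only [mem_inner, Function.comp, merge_mem_iff hv]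

/-- The extra 1 is the edge `e` itself: it crosses from S to T, so it is inside the union but inside
neither set. -/
lemma inner_supermodular {S T : Finset α} (he : e ∈ E) (hsS : s e ∈ S) (htS : t e ∉ S)
    (hsT : s e ∉ T) (htT : t e ∈ T) :
    #(inner s t E S) + #(inner s t E T) + 1 ≤
      #(inner s t E (S ∪ T)) + #(inner s t E (S ∩ T)) := by
  have h1 : inner s t E S ∩ inner s t E T = inner s t E (S ∩ T) := by
    ext f; simp only [mem_inner, mem_inter]; tauto
  have h2 : insert e (inner s t E S ∪ inner s t E T) ⊆ inner s t E (S ∪ T) := by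
    intro f
    simp only [mem_inner, mem_union, mem_insert]
    rintro (rfl | h | h)
    · tauto
    · tauto
    · tauto
  have h3 := card_le_card h2
  rw [card_insert_of_notMem (by simp [mem_inner, htS, hsT])] at h3
  have h4 := card_union_add_card_inter (inner s t E S) (inner s t E T)
  rw [h1] at h4
  omega

/-- A vector `x` has a tight set separating `t e` from `s e`. -/
def HasTight (s t : β → α) (V : Finset α) (E : Finset β) (e : β) (x : α → ℤ) : Prop :=
  ∃ T ⊆ V, t e ∈ T ∧ s e ∉ T ∧ ∑ a ∈ T, x a = #(inner s t E T) + 1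

/-- The effect on vectors of contracting an edge from `u` to `v`. -/
def contractVec (u v : α) (x : α → ℤ) (a : α) : ℤ :=
  if a = v then 0 else if a = u then x u + x v - 1 else x a

lemma sum_eq_of_agree {S : Finset α} {u v : α} {x y : α → ℤ}
    (h : ∀ a, a ≠ u → a ≠ v → x a = y a) (hu : u ∉ S) (hv : v ∉ S) :
    ∑ a ∈ S, x a = ∑ a ∈ S, y a :=
  sum_congr rfl fun a ha => h a (by rintro rfl; exact hu ha) (by rintro rfl; exact hv ha)

lemma contractVec_of_ne {u v a : α} {x : α → ℤ} (hu : a ≠ u) (hv : a ≠ v) :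
    contractVec u v x a = x a := by
  simp [contractVec, hu, hv]

lemma sum_contractVec {S : Finset α} {u v : α} (huv : u ≠ v) (hv : v ∉ S) (hu : u ∈ S)
    (x : α → ℤ) : ∑ a ∈ S, contractVec u v x a = ∑ a ∈ insert v S, x a - 1 := by
  rw [sum_insert hv, ← add_sum_erase _ _ hu, ← add_sum_erase S x hu]
  rw [sum_eq_of_agree (x := contractVec u v x) (y := x) (u := u) (v := v)
    (fun a h1 h2 => contractVec_of_ne h1 h2) (by simp) (by simp [hv])]
  simp [contractVec, huv]
  ring

lemma contractVec_mem (huv : s e ≠ t e) (he : e ∈ E) (hs : s e ∈ V) (ht : t e ∈ V) {x : α → ℤ}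
    (hx : x ∈ scoreVectors s t V E) :
    contractVec (s e) (t e) x ∈
      scoreVectors (merge (s e) (t e) ∘ s) (merge (s e) (t e) ∘ t) (V.erase (t e)) (E.erase e) := by
  obtain ⟨h0, h1, h2⟩ := hx
  refine ⟨?_, ?_, ?_⟩
  · intro a ha
    by_cases hav : a = t e
    · simp [contractVec, hav]
    · have haV : a ∉ V := fun h => ha (mem_erase.2 ⟨hav, h⟩)
      rw [contractVec_of_ne (by rintro rfl; exact haV hs) hav, h0 a haV]
  · intro S hS hne
    have hv : t e ∉ S := fun h => notMem_erase _ _ (hS h)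
    have hSV : S ⊆ V := hS.trans (erase_subset _ _)
    rw [inner_merge hv]
    by_cases hu : s e ∈ S
    · rw [sum_contractVec huv hv hu, unmerge, if_pos hu]
      have := h1 (insert (t e) S) (insert_subset ht hSV) (by simp)
      have h3 := inner_erase_of_mem (s := s) (t := t) he
        (mem_insert_of_mem (b := t e) hu) (mem_insert_self _ _)
      omega
    · rw [unmerge, if_neg hu, inner_erase_of_not_mem (by tauto),
        sum_eq_of_agree (x := contractVec _ _ x) (y := x)
          (fun a h1 h2 => contractVec_of_ne h1 h2) hu hv]
      exact h1 S hSV hne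
  · rw [sum_contractVec huv (notMem_erase _ _) (mem_erase.2 ⟨huv, hs⟩), insert_erase ht, h2]
    have := card_erase_add_one he
    omega

/-- Vectors with the same contraction agree away from the two ends of `e`. On a tight set of `x`
they can thus differ only at `t e`, where `x` is already as small as the constraint permits. -/
lemma le_of_hasTight {x y : α → ℤ} (hx : HasTight s t V E e x)
    (hy : y ∈ scoreVectors s t V E)
    (h : contractVec (s e) (t e) x = contractVec (s e) (t e) y) : x (t e) ≤ y (t e) := by
  obtain ⟨T, hTV, hv, hu, hT⟩ := hx
  have h1 := hy.2.1 T hTV ⟨_, hv⟩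
  rw [← hT, ← add_sum_erase _ _ hv, ← add_sum_erase _ y hv] at h1
  rw [sum_eq_of_agree (x := x) (y := y) (u := s e) (v := t e) _ (by simp [hu]) (by simp)] at h1
  · omega
  · intro a h2 h3
    have := congrFun h a
    rwa [contractVec_of_ne h2 h3, contractVec_of_ne h2 h3] at this

lemma contractVec_injOn (huv : s e ≠ t e) :
    Set.InjOn (contractVec (s e) (t e)) {x ∈ scoreVectors s t V E | HasTight s t V E e x} := by
  intro x hx y hy h
  have hv := le_antisymm (le_of_hasTight hx.2 hy.1 h) (le_of_hasTight hy.2 hx.1 h.symm)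
  ext a
  by_cases h1 : a = t e
  · rw [h1, hv]
  by_cases h2 : a = s e
  · have := congrFun h (s e)
    simp only [contractVec, huv, if_false, if_true] at this
    rw [h2]
    omega
  · have := congrFun h a
    rwa [contractVec_of_ne h2 h1, contractVec_of_ne h2 h1] at this

lemma exists_contractVec_eq (huv : s e ≠ t e) (he : e ∈ E) (hs : s e ∈ V) (ht : t e ∈ V)
    {y : α → ℤ} (hy : y ∈ scoreVectors (merge (s e) (t e) ∘ s) (merge (s e) (t e) ∘ t)
      (V.erase (t e)) (E.erase e)) :
    ∃ x ∈ scoreVectors s t V E, HasTight s t V E e x ∧ contractVec (s e) (t e) x = y := by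
  obtain ⟨h0, h1, h2⟩ := hy
  -- Once `y` fixes the other values, each set containing `t e` but not `s e` bounds the value at `t
  -- e` from below. The largest bound is taken as that value, so the maximizing set becomes tight.
  obtain ⟨T, hT, hmax⟩ := exists_max_image (V.powerset.filter fun T => t e ∈ T ∧ s e ∉ T)
    (fun T => (#(inner s t E T) : ℤ) + 1 - ∑ a ∈ T.erase (t e), y a)
    ⟨{t e}, by simp [ht, huv]⟩
  simp only [mem_filter, mem_powerset] at hT hmax
  obtain ⟨hTV, hvT, huT⟩ := hT
  set b : ℤ := (#(inner s t E T) : ℤ) + 1 - ∑ a ∈ T.erase (t e), y a with hb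
  set x : α → ℤ := fun a => if a = t e then b else if a = s e then y (s e) + 1 - b else y a with hx
  have hxv : x (t e) = b := by simp [hx]
  have hxu : x (s e) = y (s e) + 1 - b := by simp [hx, huv]
  have hxa : ∀ a, a ≠ s e → a ≠ t e → x a = y a := fun a h3 h4 => by simp [hx, h3, h4]
  have hyv : y (t e) = 0 := h0 _ (notMem_erase _ _)
  have hc : contractVec (s e) (t e) x = y := by
    ext a
    by_cases h4 : a = t e
    · rw [h4, hyv]; simp [contractVec]
    by_cases h3 : a = s e
    · rw [h3]
      simp only [contractVec, huv, if_false, if_true, hxu, hxv]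
      ring
    · rw [contractVec_of_ne h3 h4, hxa a h3 h4]
  have hboth : ∀ S, s e ∈ S → t e ∈ S → ∑ a ∈ S, x a = ∑ a ∈ S.erase (t e), y a + 1 := by
    intro S h3 h4
    rw [← hc, sum_contractVec huv (notMem_erase _ _) (mem_erase.2 ⟨huv, h3⟩), insert_erase h4]
    ring
  have hv_only : ∀ S, s e ∉ S → t e ∈ S → ∑ a ∈ S, x a = ∑ a ∈ S.erase (t e), y a + b := by
    intro S h3 h4
    rw [← add_sum_erase _ _ h4, hxv, sum_eq_of_agree hxa (by simp [h3]) (by simp)]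
    ring
  have hu_only : ∀ S, s e ∈ S → t e ∉ S → ∑ a ∈ S, x a = ∑ a ∈ S, y a + 1 - b := by
    intro S h3 h4
    rw [← add_sum_erase _ _ h3, hxu, sum_eq_of_agree hxa (by simp) (by simp [h4]),
      ← add_sum_erase S y h3]
    ring
  have hyS : ∀ S ⊆ V, S.Nonempty → s e ∉ S → t e ∉ S →
      (#(inner s t E S) : ℤ) + 1 ≤ ∑ a ∈ S, y a := by
    intro S hS hne h3 h4
    have := h1 S (subset_erase.2 ⟨hS, h4⟩) hne
    rwa [inner_merge h4, unmerge, if_neg h3, inner_erase_of_not_mem (by tauto)] at this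
  have hyS' : ∀ S ⊆ V, s e ∈ S → t e ∈ S →
      (#(inner s t E S) : ℤ) ≤ ∑ a ∈ S.erase (t e), y a := by
    intro S hS h3 h4
    have := h1 (S.erase (t e)) (erase_subset_erase _ hS) ⟨s e, mem_erase.2 ⟨huv, h3⟩⟩
    rw [inner_merge (notMem_erase _ _), unmerge_erase huv (by tauto)] at this
    have h5 := inner_erase_of_mem (s := s) (t := t) he h3 h4
    omega
  refine ⟨x, ⟨?_, ?_, ?_⟩, ⟨T, hTV, hvT, huT, ?_⟩, hc⟩
  · intro a ha
    rw [hxa a (by rintro rfl; exact ha hs) (by rintro rfl; exact ha ht)]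
    exact h0 a fun h => ha (mem_of_mem_erase h)
  · intro S hS hne
    by_cases h3 : s e ∈ S <;> by_cases h4 : t e ∈ S
    · rw [hboth S h3 h4]
      have := hyS' S hS h3 h4
      omega
    · rw [hu_only S h3 h4]
      -- The critical case: giving `t e` the value `b` leaves less for `s e`. Uncrossing S with the
      -- maximizer T shows that enough remains.
      have hsup := inner_supermodular (t := t) he h3 h4 huT hvT
      have hU := hyS' (S ∪ T) (union_subset hS hTV) (by simp [h3]) (by simp [hvT])
      have hI : (#(inner s t E (S ∩ T)) : ℤ) ≤ ∑ a ∈ S ∩ T, y a := by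
        rcases (S ∩ T).eq_empty_or_nonempty with h5 | h5
        · simp [h5, inner_empty]
        · have := hyS (S ∩ T) (inter_subset_left.trans hS) h5 (by simp [huT]) (by simp [h4])
          omega
      have hsum := sum_union_inter (s₁ := S) (s₂ := T.erase (t e)) (f := y)
      rw [show S ∪ T.erase (t e) = (S ∪ T).erase (t e) by
          rw [erase_union_distrib, erase_eq_of_notMem h4],
        show S ∩ T.erase (t e) = S ∩ T by
          rw [inter_erase, erase_eq_of_notMem (by simp [h4])]] at hsum
      omega
    · rw [hv_only S h3 h4]
      have := hmax S ⟨hS, h4, h3⟩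
      omega
    · rw [sum_eq_of_agree hxa h3 h4]
      exact hyS S hS hne h3 h4
  · rw [hboth V hs ht, h2]
    have := card_erase_add_one he
    omega
  · rw [hv_only T huT hvT, hb]
    ring

lemma sum_add_single (S : Finset α) (v : α) (x : α → ℤ) :
    ∑ a ∈ S, (x + Pi.single v 1 : α → ℤ) a = ∑ a ∈ S, x a + if v ∈ S then 1 else 0 := by
  simp [sum_add_distrib, Pi.single_apply]

/-- Restoring `e` and adding one at `t e` raises both sides of the constraint for sets containing
both ends. For sets containing only `t e` just the sum grows, so the inequality becomes strict; that
is the absence of a separating tight set. -/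
lemma image_add_single (he : e ∈ E) (ht : t e ∈ V) :
    (fun x : α → ℤ => x + Pi.single (t e) 1) '' scoreVectors s t V (E.erase e) =
      {x ∈ scoreVectors s t V E | ¬ HasTight s t V E e x} := by
  have hcard := card_erase_add_one he
  ext x
  constructor
  · rintro ⟨y, ⟨h0, h1, h2⟩, rfl⟩
    refine ⟨⟨?_, ?_, ?_⟩, ?_⟩
    · intro a ha
      have : a ≠ t e := by rintro rfl; exact ha ht
      simp [h0 a ha, this]
    · intro S hS hne
      rw [sum_add_single]
      have h3 := h1 S hS hne
      by_cases h4 : s e ∈ S ∧ t e ∈ S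
      · have := inner_erase_of_mem (s := s) (t := t) he h4.1 h4.2
        rw [if_pos h4.2]
        omega
      · rw [inner_erase_of_not_mem h4] at h3
        split_ifs <;> omega
    · rw [sum_add_single, if_pos ht, h2]
      omega
    · rintro ⟨T, hT, hv, hu, h⟩
      rw [sum_add_single, if_pos hv] at h
      have h3 := h1 T hT ⟨_, hv⟩
      rw [inner_erase_of_not_mem (by tauto)] at h3
      omega
  · rintro ⟨⟨h0, h1, h2⟩, h3⟩
    have hsum : ∀ S : Finset α, ∑ a ∈ S, (x - Pi.single (t e) 1 : α → ℤ) a =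
        ∑ a ∈ S, x a - if t e ∈ S then 1 else 0 := by
      intro S
      simp [Pi.single_apply]
    refine ⟨x - Pi.single (t e) 1, ⟨?_, ?_, ?_⟩, by simp⟩
    · intro a ha
      have : a ≠ t e := by rintro rfl; exact ha ht
      simp [h0 a ha, this]
    · intro S hS hne
      rw [hsum]
      have h4 := h1 S hS hne
      by_cases hu : s e ∈ S <;> by_cases hv : t e ∈ S
      · have := inner_erase_of_mem (s := s) (t := t) he hu hv
        rw [if_pos hv]
        omega
      · rwa [if_neg hv, inner_erase_of_not_mem (by tauto), sub_zero]
      · rw [if_pos hv, inner_erase_of_not_mem (by tauto)]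
        have : ∑ a ∈ S, x a ≠ #(inner s t E S) + 1 := fun h => h3 ⟨S, hS, hv, hu, h⟩
        omega
      · rwa [if_neg hv, inner_erase_of_not_mem (by tauto), sub_zero]
    · rw [hsum, if_pos ht, h2]
      omega

theorem encard_scoreVectors_eq_add (huv : s e ≠ t e) (he : e ∈ E) (hs : s e ∈ V) (ht : t e ∈ V) :
    (scoreVectors s t V E).encard = (scoreVectors s t V (E.erase e)).encard +
      (scoreVectors (merge (s e) (t e) ∘ s) (merge (s e) (t e) ∘ t)
        (V.erase (t e)) (E.erase e)).encard := by
  have hinj : Function.Injective fun x : α → ℤ => x + Pi.single (t e) 1 :=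
    add_left_injective _
  have himg : contractVec (s e) (t e) '' {x ∈ scoreVectors s t V E | HasTight s t V E e x} =
      scoreVectors (merge (s e) (t e) ∘ s) (merge (s e) (t e) ∘ t)
        (V.erase (t e)) (E.erase e) := by
    ext y
    constructor
    · rintro ⟨x, hx, rfl⟩
      exact contractVec_mem huv he hs ht hx.1
    · intro hy
      obtain ⟨x, hx, hx', rfl⟩ := exists_contractVec_eq huv he hs ht hy
      exact ⟨x, ⟨hx, hx'⟩, rfl⟩
  rw [← hinj.encard_image (scoreVectors s t V (E.erase e)), image_add_single he ht, ← himg,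
    (contractVec_injOn huv).encard_image, ← Set.encard_union_eq]
  · congr 1
    ext x
    simp only [Set.mem_union, Set.mem_sep_iff]
    tauto
  · rw [Set.disjoint_left]
    exact fun x hx hx' => hx.2 hx'.2

/-! ### Deletion–contraction for spanning trees. -/

/-- Cuts of the contraction are the cuts that keep both ends of `e` on one side; all other cuts are
crossed by `e`. -/
lemma cutConnected_merge (huv : s e ≠ t e) {F : Finset β} (hs : s e ∈ V) (ht : t e ∈ V) :
    CutConnected (merge (s e) (t e) ∘ s) (merge (s e) (t e) ∘ t) (V.erase (t e)) F ↔
      CutConnected s t V (insert e F) := by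
  constructor
  · intro h S hS hne hSV
    by_cases hst : s e ∈ S ↔ t e ∈ S
    · have hne' : (S.erase (t e)).Nonempty := by
        obtain ⟨a, ha⟩ := hne
        by_cases h1 : a = t e
        · exact ⟨s e, mem_erase.2 ⟨huv, hst.2 (h1 ▸ ha)⟩⟩
        · exact ⟨a, mem_erase.2 ⟨h1, ha⟩⟩
      obtain ⟨f, hf, hfS⟩ := h (S.erase (t e)) (erase_subset_erase _ hS) hne' (by
        intro h1
        apply hSV
        rw [← unmerge_erase huv hst, h1, unmerge_erase huv (by tauto)])
      simp only [Function.comp, merge_mem_erase_iff huv hst] at hfS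
      exact ⟨f, mem_insert_of_mem hf, hfS⟩
    · exact ⟨e, mem_insert_self _ _, hst⟩
  · intro h S hS hne hSV
    have hv : t e ∉ S := fun h => notMem_erase _ _ (hS h)
    have hSV' : S ⊆ V := hS.trans (erase_subset _ _)
    have hsub : S ⊆ unmerge (s e) (t e) S := by
      unfold unmerge
      split_ifs
      · exact subset_insert _ _
      · rfl
    have hsub' : unmerge (s e) (t e) S ⊆ V := by
      unfold unmerge
      split_ifs
      · exact insert_subset ht hSV'
      · exact hSV'
    obtain ⟨f, hf, hfS⟩ := h (unmerge (s e) (t e) S) hsub' (hne.mono hsub) (by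
      intro h1
      apply hSV
      refine hS.antisymm fun a ha => ?_
      have h2 : a ∈ unmerge (s e) (t e) S := h1 ▸ mem_of_mem_erase ha
      rw [← merge_mem_iff hv] at h2
      simpa [merge, ne_of_mem_erase ha] using h2)
    simp only [← merge_mem_iff hv] at hfS
    rcases mem_insert.1 hf with rfl | hf
    · simp [merge, huv] at hfS
    · exact ⟨f, hf, hfS⟩

theorem card_treeEdgeSets_eq_add (huv : s e ≠ t e) (he : e ∈ E) (hs : s e ∈ V) (ht : t e ∈ V) :
    #(treeEdgeSets s t V E) = #(treeEdgeSets s t V (E.erase e)) +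
      #(treeEdgeSets (merge (s e) (t e) ∘ s) (merge (s e) (t e) ∘ t)
        (V.erase (t e)) (E.erase e)) := by
  classical
  have hV := card_erase_add_one ht
  rw [← card_filter_add_card_filter_not (s := treeEdgeSets s t V E) (fun F => e ∉ F)]
  congr 1
  · congr 1
    ext F
    simp only [mem_filter, mem_treeEdgeSets, subset_erase]
    tauto
  · refine card_bij' (fun F _ => F.erase e) (fun F _ => insert e F) ?_ ?_ ?_ ?_
    · intro F hF
      simp only [mem_filter, mem_treeEdgeSets, not_not] at hF ⊢
      obtain ⟨⟨hFE, hF, hc⟩, heF⟩ := hF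
      have := card_erase_add_one heF
      refine ⟨erase_subset_erase _ hFE, ?_, by omega⟩
      rwa [cutConnected_merge huv hs ht, insert_erase heF]
    · intro F hF
      simp only [mem_filter, mem_treeEdgeSets, not_not] at hF ⊢
      obtain ⟨hFE, hF, hc⟩ := hF
      have heF : e ∉ F := fun h => notMem_erase _ _ (hFE h)
      refine ⟨⟨insert_subset he (hFE.trans (erase_subset _ _)), ?_, ?_⟩, mem_insert_self _ _⟩
      · rwa [← cutConnected_merge huv hs ht]
      · rw [card_insert_of_notMem heF]
        omega
    · intro F hF
      simp only [mem_filter, not_not] at hF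
      exact insert_erase hF.2
    · intro F hF
      exact erase_insert fun h => notMem_erase _ _ ((mem_treeEdgeSets.1 hF).1 h)

end Recursion

/-! ### The case of loops only, and the induction. -/

lemma encard_scoreVectors_of_loops {s t : β → α} {V : Finset α} {E : Finset β} (hV : V.Nonempty)
    (hs : ∀ e ∈ E, s e ∈ V) (h : ∀ e ∈ E, s e = t e) :
    (scoreVectors s t V E).encard = #(treeEdgeSets s t V E) := by
  have ht : ∀ e ∈ E, t e ∈ V := fun e he => h e he ▸ hs e he
  by_cases hV1 : #V = 1
  · obtain ⟨a, rfl⟩ := card_eq_one.1 hV1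
    have h1 : scoreVectors s t {a} E = {Pi.single a (#E + 1 : ℤ)} := by
      ext x
      constructor
      · rintro ⟨h0, -, h2⟩
        ext b
        by_cases hb : b = a
        · subst hb
          simpa using h2
        · simp [h0 b (by simpa using hb), hb]
      · rintro rfl
        refine ⟨fun b hb => by simp_all, fun S hS hne => ?_, by simp⟩
        obtain rfl := (subset_singleton_iff.1 hS).resolve_left hne.ne_empty
        simp [inner_eq_self hs ht]
    have h2 : treeEdgeSets s t {a} E = {∅} := by
      ext F
      simp only [mem_treeEdgeSets, mem_singleton, card_singleton]
      constructor
      · rintro ⟨-, -, h⟩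
        exact card_eq_zero.1 (by omega)
      · rintro rfl
        refine ⟨empty_subset _, fun S hS hne hSa => ?_, rfl⟩
        exact absurd ((subset_singleton_iff.1 hS).resolve_left hne.ne_empty) hSa
    simp [h1, h2]
  · obtain ⟨a, ha⟩ := hV
    have hpos : 0 < #V := card_pos.2 ⟨a, ha⟩
    have hne : ({a} : Finset α) ≠ V := fun h => hV1 (by simp [← h])
    have hne' : (V.erase a).Nonempty := card_pos.1 (by rw [card_erase_of_mem ha]; omega)
    have h1 : scoreVectors s t V E = ∅ := by
      refine Set.eq_empty_of_forall_notMem ?_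
      rintro x ⟨-, h1, h2⟩
      have h3 := h1 {a} (by simpa using ha) (by simp)
      have h4 := h1 (V.erase a) (erase_subset _ _) hne'
      rw [sum_singleton] at h3
      rw [← add_sum_erase _ _ ha] at h2
      -- Loops never cross between `{a}` and its complement, so the two constraints add up to at
      -- least |E| + 2, exceeding the prescribed total |E| + 1.
      have h5 : E ⊆ inner s t E {a} ∪ inner s t E (V.erase a) := by
        intro e he
        have := hs e he
        have := h e he
        by_cases h6 : s e = a
        · exact mem_union_left _ (mem_inner.2 ⟨he, by simp_all⟩)
        · exact mem_union_right _ (mem_inner.2 ⟨he, by simp_all⟩)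
      have h6 := (card_le_card h5).trans (card_union_le _ _)
      omega
    have h2 : treeEdgeSets s t V E = ∅ := by
      refine eq_empty_of_forall_notMem fun F hF => ?_
      obtain ⟨hFE, hF, -⟩ := mem_treeEdgeSets.1 hF
      obtain ⟨e, he, h3⟩ := hF {a} (by simpa using ha) (by simp) hne
      rw [h e (hFE he)] at h3
      exact h3 Iff.rfl
    simp [h1, h2]

theorem encard_scoreVectors (s t : β → α) {V : Finset α} {E : Finset β} (hV : V.Nonempty)
    (hs : ∀ e ∈ E, s e ∈ V) (ht : ∀ e ∈ E, t e ∈ V) :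
    (scoreVectors s t V E).encard = #(treeEdgeSets s t V E) := by
  induction hn : #E generalizing s t V E with
  | zero =>
    obtain rfl := card_eq_zero.1 hn
    exact encard_scoreVectors_of_loops hV hs (by simp)
  | succ n ih =>
    by_cases h : ∀ e ∈ E, s e = t e
    · exact encard_scoreVectors_of_loops hV hs h
    push Not at h
    obtain ⟨e, he, huv⟩ := h
    have hn' : #(E.erase e) = n := by rw [card_erase_of_mem he]; omega
    have hmem : ∀ a ∈ V, merge (s e) (t e) a ∈ V.erase (t e) := fun a ha =>
      (merge_mem_erase_iff huv (by simp [hs e he, ht e he])).2 ha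
    rw [encard_scoreVectors_eq_add huv he (hs e he) (ht e he),
      card_treeEdgeSets_eq_add huv he (hs e he) (ht e he),
      ih s t hV (fun f hf => hs f (mem_of_mem_erase hf)) (fun f hf => ht f (mem_of_mem_erase hf))
        hn',
      ih (merge (s e) (t e) ∘ s) (merge (s e) (t e) ∘ t) ⟨s e, mem_erase.2 ⟨huv, hs e he⟩⟩
        (fun f hf => hmem _ (hs f (mem_of_mem_erase hf)))
        (fun f hf => hmem _ (ht f (mem_of_mem_erase hf))) hn']
    push_cast
    rfl

/-! ### Edge counts of connected multigraphs. -/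

/-- Contract a non-loop edge, find the subset in the contraction by induction, and put the edge
back. -/
lemma exists_subset_cutConnected {s t : β → α} {V : Finset α} {F : Finset β} (hV : V.Nonempty)
    (hs : ∀ e ∈ F, s e ∈ V) (ht : ∀ e ∈ F, t e ∈ V) (hF : CutConnected s t V F) :
    ∃ F' ⊆ F, CutConnected s t V F' ∧ #F' + 1 = #V := by
  induction hn : #F generalizing s t V F with
  | zero =>
    refine ⟨F, Subset.rfl, hF, ?_⟩
    obtain rfl := card_eq_zero.1 hn
    obtain ⟨a, ha⟩ := hV
    by_contra h
    obtain ⟨e, he, -⟩ := hF {a} (by simpa using ha) (by simp) (by rintro rfl; simp at h)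
    simp at he
  | succ n ih =>
    obtain ⟨a, ha⟩ := hV
    by_cases hV1 : ({a} : Finset α) = V
    · refine ⟨∅, empty_subset _, ?_, by simp [← hV1]⟩
      intro S hS hne hSV
      rw [← hV1] at hS hSV
      exact absurd ((subset_singleton_iff.1 hS).resolve_left hne.ne_empty) hSV
    obtain ⟨e, he, hea⟩ := hF {a} (by simpa using ha) (by simp) hV1
    have huv : s e ≠ t e := fun h => hea (by rw [h])
    have hmem : ∀ a ∈ V, merge (s e) (t e) a ∈ V.erase (t e) := fun a ha =>
      (merge_mem_erase_iff huv (by simp [hs e he, ht e he])).2 ha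
    obtain ⟨F', hF', hF'c, hcard⟩ := ih (s := merge (s e) (t e) ∘ s)
      (t := merge (s e) (t e) ∘ t) (V := V.erase (t e)) (F := F.erase e)
      ⟨s e, mem_erase.2 ⟨huv, hs e he⟩⟩
      (fun f hf => hmem _ (hs f (mem_of_mem_erase hf)))
      (fun f hf => hmem _ (ht f (mem_of_mem_erase hf)))
      ((cutConnected_merge huv (hs e he) (ht e he)).2 (by rwa [insert_erase he]))
      (by rw [card_erase_of_mem he]; omega)
    refine ⟨insert e F', insert_subset he (hF'.trans (erase_subset _ _)),
      (cutConnected_merge huv (hs e he) (ht e he)).1 hF'c, ?_⟩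
    rw [card_insert_of_notMem fun h => notMem_erase _ _ (hF' h), hcard]
    exact card_erase_add_one (ht e he)

lemma card_le_of_cutConnected {s t : β → α} {V : Finset α} {F : Finset β} (hV : V.Nonempty)
    (hs : ∀ e ∈ F, s e ∈ V) (ht : ∀ e ∈ F, t e ∈ V) (hF : CutConnected s t V F) :
    #V ≤ #F + 1 := by
  obtain ⟨F', hF', -, h⟩ := exists_subset_cutConnected hV hs ht hF
  have := card_le_card hF'
  omega

/-! ### Connectedness, cycles and trees in terms of end maps. -/

/-- The ends of the edges of `H` are given by `s` and `t`, its vertices and edges by `V` and `F`. -/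
structure Represents (s t : β → α) (V : Finset α) (F : Finset β) (H : Graph α β) : Prop where
  vertexSet_eq : V(H) = V
  edgeSet_eq : E(H) = F
  isLink : ∀ e ∈ F, H.IsLink e (s e) (t e)

section Represents

variable {s t : β → α} {V : Finset α} {F : Finset β} {H : Graph α β}

lemma Represents.left_mem (h : Represents s t V F H) {e : β} (he : e ∈ F) : s e ∈ V := by
  have := (h.isLink e he).left_mem
  rwa [h.vertexSet_eq] at this

lemma Represents.right_mem (h : Represents s t V F H) {e : β} (he : e ∈ F) : t e ∈ V := by
  have := (h.isLink e he).right_mem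
  rwa [h.vertexSet_eq] at this

lemma Represents.ends_eq (h : Represents s t V F H) {e : β} {x y : α} (he : H.IsLink e x y) :
    e ∈ F ∧ (s e = x ∧ t e = y ∨ s e = y ∧ t e = x) := by
  have heF : e ∈ F := by
    have := he.edge_mem
    rwa [h.edgeSet_eq] at this
  exact ⟨heF, (h.isLink e heF).eq_and_eq_or_eq_and_eq he⟩

lemma Represents.connected_iff (h : Represents s t V F H) :
    H.Connected ↔ V.Nonempty ∧ CutConnected s t V F := by
  unfold Graph.Connected
  rw [h.vertexSet_eq, coe_nonempty]
  refine and_congr_right fun _ => ⟨?_, ?_⟩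
  · rintro hc S hS ⟨x, hx⟩ hSV
    obtain ⟨y, hyV, hyS⟩ := exists_of_ssubset (hS.ssubset_of_ne hSV)
    by_contra! hcross
    apply hyS
    induction hc x (hS hx) y hyV with
    | refl => exact hx
    | @tail b c _ hbc ih =>
      obtain ⟨e, hbc⟩ := hbc
      have hbV : b ∈ V := by
        have := hbc.left_mem
        rwa [h.vertexSet_eq] at this
      have hb : b ∈ S := by
        by_contra hb
        exact hb (ih hbV hb)
      obtain ⟨he, ⟨h1, h2⟩ | ⟨h1, h2⟩⟩ := h.ends_eq hbc
      · exact h2 ▸ (hcross e he).1 (h1 ▸ hb)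
      · exact h1 ▸ (hcross e he).2 (h2 ▸ hb)
  · intro hc x hx y hy
    classical
    by_contra hxy
    obtain ⟨e, he, hcross⟩ := hc (V.filter fun z => Relation.ReflTransGen H.Adj x z)
      (filter_subset _ _) ⟨x, by simpa using ⟨hx, .refl⟩⟩ (fun h' => hxy (by
        rw [← h'] at hy
        exact (mem_filter.1 hy).2))
    apply hcross
    have h1 := (h.isLink e he).adj
    simp only [mem_filter, h.left_mem he, h.right_mem he, true_and]
    exact ⟨fun h2 => h2.tail h1, fun h2 => h2.tail h1.symm⟩

lemma Represents.not_hasCycle (h : Represents s t V F H) (hV : V.Nonempty)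
    (hF : CutConnected s t V F) (hcard : #F + 1 = #V) : ¬ H.HasCycle := by
  rintro ⟨k, v, e, -, he, hlink⟩
  have hl := hlink (Fin.last k)
  rw [Fin.last_add_one] at hl
  obtain ⟨heF, hends⟩ := h.ends_eq hl
  -- Removing one edge of a cycle keeps every cut crossed, yet leaves too few edges.
  suffices CutConnected s t V (F.erase (e (Fin.last k))) by
    have h1 := card_le_of_cutConnected hV (fun f hf => h.left_mem (mem_of_mem_erase hf))
      (fun f hf => h.right_mem (mem_of_mem_erase hf)) this
    have h2 := card_erase_add_one heF
    omega
  intro S hS hne hSV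
  by_contra! hcross
  obtain ⟨f, hf, hfS⟩ := hF S hS hne hSV
  by_cases hfe : f = e (Fin.last k)
  · have hall : ∀ i : Fin (k + 1), v i ∈ S ↔ v 0 ∈ S := by
      intro i
      induction i using Fin.induction with
      | zero => rfl
      | succ i ih =>
        rw [← ih]
        obtain ⟨h1, h2⟩ := h.ends_eq (hlink i.castSucc)
        have h3 := hcross _ (mem_erase.2 ⟨fun h4 => Fin.castSucc_ne_last i (he h4), h1⟩)
        rw [Fin.coeSucc_eq_succ] at h2
        rcases h2 with ⟨h5, h6⟩ | ⟨h5, h6⟩ <;> rw [h5, h6] at h3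
        exacts [h3.symm, h3]
    apply hfS
    have := hall (Fin.last k)
    rcases hends with ⟨h5, h6⟩ | ⟨h5, h6⟩ <;> rw [hfe, h5, h6]
    exacts [this, this.symm]
  · exact hfS (hcross f (mem_erase.2 ⟨hfe, hf⟩))

/-- A path in `F'` between the ends of `e` is closed up by `e`. If `e` is a loop the path has length
0. -/
lemma Represents.hasCycle (h : Represents s t V F H) {F' : Finset β} (hF' : F' ⊆ F)
    (hc : CutConnected s t V F') {e : β} (he : e ∈ F) (he' : e ∉ F') : H.HasCycle := by
  classical
  let K : SimpleGraph α := SimpleGraph.fromRel fun x y => ∃ f ∈ F', s f = x ∧ t f = y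
  have hreach : K.Reachable (s e) (t e) := by
    by_contra hxy
    obtain ⟨f, hf, hcross⟩ := hc (V.filter fun z => K.Reachable (s e) z)
      (filter_subset _ _) ⟨s e, by simpa using h.left_mem he⟩ (fun h' => hxy (by
        have := h.right_mem he
        rw [← h'] at this
        exact (mem_filter.1 this).2))
    have hne : s f ≠ t f := fun h1 => hcross (by rw [h1])
    have hadj : K.Adj (s f) (t f) := ⟨hne, .inl ⟨f, hf, rfl, rfl⟩⟩
    apply hcross
    simp only [mem_filter, h.left_mem (hF' hf), h.right_mem (hF' hf), true_and]
    exact ⟨fun h2 => h2.trans hadj.reachable, fun h2 => h2.trans hadj.symm.reachable⟩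
  obtain ⟨p, hp⟩ := hreach.exists_isPath
  have hex : ∀ i, ∃ f, i < p.length → f ∈ F' ∧ H.IsLink f (p.getVert i) (p.getVert (i + 1)) := by
    intro i
    by_cases hi : i < p.length
    · obtain ⟨-, ⟨f, hf, h1, h2⟩ | ⟨f, hf, h1, h2⟩⟩ := p.adj_getVert_succ hi
      · exact ⟨f, fun _ => ⟨hf, h1 ▸ h2 ▸ h.isLink f (hF' hf)⟩⟩
      · exact ⟨f, fun _ => ⟨hf, h1 ▸ h2 ▸ (h.isLink f (hF' hf)).symm⟩⟩
    · exact ⟨e, fun h => absurd h hi⟩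
  choose g hg using hex
  have hinj := hp.getVert_injOn
  refine ⟨p.length, fun i => p.getVert i, fun i => if (i : ℕ) < p.length then g i else e,
    ?_, ?_, ?_⟩
  · intro i j hij
    exact Fin.ext (hinj (Nat.lt_succ_iff.1 i.2) (Nat.lt_succ_iff.1 j.2) hij)
  · intro i j hij
    have hi := i.2
    have hj := j.2
    apply Fin.ext
    dsimp only at hij
    split_ifs at hij with h1 h2 h2
    · obtain ⟨-, hgi⟩ := hg i h1
      obtain ⟨-, hgj⟩ := hg j h2
      rw [hij] at hgi
      rcases hgi.eq_and_eq_or_eq_and_eq hgj with ⟨h3, -⟩ | ⟨h3, h4⟩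
      · exact hinj (by simp; omega) (by simp; omega) h3
      -- Traversing one edge in opposite directions would force i = j + 1 and i + 1 = j.
      · have h5 := hinj (by simp; omega) (by simp; omega) h3
        have h6 := hinj (by simp; omega) (by simp; omega) h4
        omega
    · exact absurd (hij ▸ (hg i h1).1) he'
    · exact absurd (hij ▸ (hg j h2).1) he'
    · omega
  · intro i
    induction i using Fin.lastCases with
    | last => simpa using (h.isLink e he).symm
    | cast i => simpa [Fin.coeSucc_eq_succ] using (hg i i.2).2

lemma Represents.isTree_iff (h : Represents s t V F H) (hV : V.Nonempty) :
    H.IsTree ↔ CutConnected s t V F ∧ #F + 1 = #V := by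
  unfold Graph.IsTree
  rw [h.connected_iff]
  constructor
  · rintro ⟨⟨-, hc⟩, hcyc⟩
    refine ⟨hc, ?_⟩
    obtain ⟨F', hF', hc', hcard⟩ := exists_subset_cutConnected hV (fun f hf => h.left_mem hf)
      (fun f hf => h.right_mem hf) hc
    obtain rfl : F' = F := by
      refine hF'.antisymm fun e he => ?_
      by_contra he'
      exact hcyc (h.hasCycle hF' hc' he he')
    exact hcard
  · rintro ⟨hc, hcard⟩
    exact ⟨⟨hV, hc⟩, h.not_hasCycle hV hc hcard⟩

lemma Represents.of_spanning {G T : Graph α β} {E : Finset β} (h : Represents s t V E G)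
    (hT : T ≤s G) (hF : E(T) = F) : Represents s t V F T where
  vertexSet_eq := hT.vertexSet_eq.trans h.vertexSet_eq
  edgeSet_eq := hF
  isLink e he := by
    have heT : e ∈ E(T) := by rw [hF]; exact he
    have heG : e ∈ E(G) := hT.le.edgeSet_mono heT
    rw [hT.le.isLink_iff heT]
    rw [h.edgeSet_eq] at heG
    exact h.isLink e heG

/-- A spanning subgraph is determined by its edge set. -/
theorem Represents.encard_spanningTrees {G : Graph α β} {E : Finset β} (h : Represents s t V E G)
    (hV : V.Nonempty) : G.spanningTrees.encard = #(treeEdgeSets s t V E) := by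
  have hinj : Set.InjOn (fun T : Graph α β => E(T)) G.spanningTrees := by
    intro T hT T' hT' hE
    exact Graph.Compatible.ext (hT.1.vertexSet_eq.trans hT'.1.vertexSet_eq.symm) hE
      (Graph.Compatible.of_le_le hT.1.le hT'.1.le)
  have himg : (fun T : Graph α β => E(T)) '' G.spanningTrees =
      (fun F : Finset β => (F : Set β)) '' (treeEdgeSets s t V E : Set (Finset β)) := by
    ext A
    constructor
    · rintro ⟨T, ⟨hT, hT'⟩, rfl⟩
      have hsub : E(T) ⊆ E := h.edgeSet_eq ▸ hT.le.edgeSet_mono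
      obtain ⟨F, hF⟩ := (E.finite_toSet.subset hsub).exists_finset_coe
      have h1 := h.of_spanning hT hF.symm
      refine ⟨F, mem_coe.2 (mem_treeEdgeSets.2 ⟨?_, (h1.isTree_iff hV).1 hT'⟩), hF⟩
      rw [← coe_subset, hF]
      exact hsub
    · rintro ⟨F, hF, rfl⟩
      obtain ⟨hFE, hF⟩ := mem_treeEdgeSets.1 (mem_coe.1 hF)
      have h1 : G.restrict F ≤s G := ⟨Graph.restrict_le, rfl⟩
      have h2 : E(G.restrict F) = F := by
        change E(G) ∩ F = F
        rw [h.edgeSet_eq, Set.inter_eq_right]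
        exact coe_subset.2 hFE
      exact ⟨G.restrict F, ⟨h1, ((h.of_spanning h1 h2).isTree_iff hV).2 hF⟩, h2⟩
  rw [← hinj.encard_image, himg, Function.Injective.encard_image coe_injective,
    Set.encard_coe_eq_coe_finsetCard]

/-! ### Break divisors as score vectors. -/

lemma Represents.genus_eq (h : Represents s t V F H) : H.genus = (#F : ℤ) - #V + 1 := by
  simp [Graph.genus, h.vertexSet_eq, h.edgeSet_eq]

lemma Represents.induce (h : Represents s t V F H) (S : Finset α) :
    Represents s t S (inner s t F S) (H.induce S) where
  vertexSet_eq := rfl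
  edgeSet_eq := by
    ext e
    rw [Graph.edgeSet_induce]
    simp only [Set.mem_ofPred_eq, mem_coe, mem_inner]
    constructor
    · rintro ⟨x, y, hxy, hx, hy⟩
      obtain ⟨h1, ⟨rfl, rfl⟩ | ⟨rfl, rfl⟩⟩ := h.ends_eq hxy
      exacts [⟨h1, hx, hy⟩, ⟨h1, hy, hx⟩]
    · rintro ⟨h1, h2, h3⟩
      exact ⟨_, _, h.isLink e h1, h2, h3⟩
  isLink e he := by
    obtain ⟨h1, h2, h3⟩ := mem_inner.1 he
    exact ⟨h.isLink e h1, h2, h3⟩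

open Classical in
/-- The values of a divisor raised by one, extended by zero outside the vertex set. -/
noncomputable def raise {G : Graph α β} (D : G.Divisor) (a : α) : ℤ :=
  if h : a ∈ V(G) then D ⟨a, h⟩ + 1 else 0

lemma raise_injective {G : Graph α β} : Function.Injective (raise : G.Divisor → α → ℤ) := by
  intro D D' h
  ext ⟨a, ha⟩
  have := congrFun h a
  simpa [raise, ha] using this

lemma degreeOn_add_card {G : Graph α β} (D : G.Divisor) {S : Finset α} (hS : (S : Set α) ⊆ V(G)) :
    D.degreeOn S + #S = ∑ a ∈ S, raise D a := by
  have h1 : D.degreeOn S = ∑ᶠ (a : α) (_ : a ∈ (S : Set α)), (raise D a - 1) := by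
    unfold Graph.Divisor.degreeOn
    refine finsum_mem_eq_of_bijOn (s := {v : V(G) | (v : α) ∈ (S : Set α)})
      (fun v : V(G) => (v : α)) ?_ ?_
    · refine ⟨fun v hv => hv, Subtype.val_injective.injOn, ?_⟩
      intro a ha
      exact ⟨⟨a, hS ha⟩, ha, rfl⟩
    · rintro ⟨a, ha⟩ -
      simp [raise, ha]
  rw [h1, finsum_mem_coe_finset, sum_sub_distrib]
  simp

lemma degree_eq_degreeOn {G : Graph α β} (D : G.Divisor) : D.degree = D.degreeOn V(G) := by
  unfold Graph.Divisor.degree Graph.Divisor.degreeOn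
  simp

theorem Represents.encard_breakDivisors {G : Graph α β} {E : Finset β}
    (h : Represents s t V E G) : G.breakDivisors.encard = (scoreVectors s t V E).encard := by
  rw [← raise_injective.encard_image]
  congr 1
  have hdeg : ∀ D : G.Divisor, ∀ S ⊆ V, D.degreeOn S + #S = ∑ a ∈ S, raise D a :=
    fun D S hS => degreeOn_add_card D (by rw [h.vertexSet_eq]; exact coe_subset.2 hS)
  have hdeg' : ∀ D : G.Divisor, D.degree + #V = ∑ a ∈ V, raise D a := by
    intro D
    rw [degree_eq_degreeOn, h.vertexSet_eq, hdeg D V Subset.rfl]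
  ext x
  constructor
  · rintro ⟨D, ⟨-, hD, hS⟩, rfl⟩
    refine ⟨?_, ?_, ?_⟩
    · intro a ha
      have : a ∉ V(G) := by rwa [h.vertexSet_eq]
      simp [raise, this]
    · intro S hSV hne
      have h1 := hS S (by rw [h.vertexSet_eq]; exact coe_subset.2 hSV) (coe_nonempty.2 hne)
      rw [(h.induce S).genus_eq] at h1
      have := hdeg D S hSV
      omega
    · rw [h.genus_eq] at hD
      have := hdeg' D
      omega
  · rintro ⟨h0, h1, h2⟩
    have hx : raise (fun v : V(G) => x v - 1 : G.Divisor) = x := by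
      ext a
      unfold raise
      split_ifs with ha
      · simp
      · rw [h.vertexSet_eq] at ha
        exact (h0 a ha).symm
    refine ⟨_, ⟨?_, ?_, ?_⟩, hx⟩
    · rintro ⟨a, ha⟩
      rw [h.vertexSet_eq] at ha
      -- Effectivity follows from the singleton constraints.
      have := h1 {a} (by simpa using ha) (by simp)
      rw [sum_singleton] at this
      change 0 ≤ x a - 1
      omega
    · have := hdeg' (fun v : V(G) => x v - 1)
      rw [hx] at this
      rw [h.genus_eq]
      omega
    · intro S hS hne
      rw [h.vertexSet_eq] at hS
      obtain ⟨S, rfl⟩ := (V.finite_toSet.subset hS).exists_finset_coe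
      have h3 := hdeg (fun v : V(G) => x v - 1) S (coe_subset.1 hS)
      rw [hx] at h3
      have h4 := h1 S (coe_subset.1 hS) (coe_nonempty.1 hne)
      rw [(h.induce S).genus_eq]
      omega

lemma exists_represents {G : Graph α β} {E : Finset β} (hV : V(G) = V) (hE : E(G) = E)
    (hne : V.Nonempty) : ∃ s t : β → α, Represents s t V E G := by
  obtain ⟨a, -⟩ := hne
  have : ∀ e, ∃ x y, e ∈ E → G.IsLink e x y := by
    intro e
    by_cases he : e ∈ E
    · obtain ⟨x, y, hxy⟩ := G.exists_isLink_of_mem_edgeSet (e := e) (by rw [hE]; exact he)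
      exact ⟨x, y, fun _ => hxy⟩
    · exact ⟨a, a, fun h => absurd h he⟩
  choose s t hst using this
  exact ⟨s, t, hV, hE, hst⟩

end Represents

end Multigraph

theorem corollary2p2 {α β : Type*} (G : Graph α β) (hV : V(G).Finite) (hE : E(G).Finite)
    (hG : G.Connected) :
    G.breakDivisors.Finite ∧ G.spanningTrees.Finite ∧
      G.breakDivisors.ncard = G.spanningTrees.ncard := by
  classical
  obtain ⟨V, hV⟩ := hV.exists_finset_coe
  obtain ⟨E, hE⟩ := hE.exists_finset_coe
  have hne : V.Nonempty := by
    rw [← Finset.coe_nonempty, hV]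
    exact hG.1
  obtain ⟨s, t, h⟩ := Multigraph.exists_represents hV.symm hE.symm hne
  have h1 := h.encard_breakDivisors.trans
    (Multigraph.encard_scoreVectors s t hne (fun _ => h.left_mem) (fun _ => h.right_mem))
  have h2 := h.encard_spanningTrees hne
  -- Finiteness comes from the `encard` identities, whose right-hand sides are natural numbers.
  refine ⟨Set.finite_of_encard_eq_coe h1, Set.finite_of_encard_eq_coe h2, ?_⟩
  rw [Set.ncard, Set.ncard, h1, h2]
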